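/- Let $Q=(q_n)_{n\ge 1}$ be a basic sequence, i.e. a sequence of integers $q_n\ge 2$, and suppose that $Q$ is infinite in limit, i.e. $\lim_{n\to\infty}q_n=\infty$. For real $x$ and $n\ge 0$ let $T_{Q,n}(x)\in[0,1)$ be the fractional part of $q_nq_{n-1}\cdots q_1x$ (so $T_{Q,0}(x)$ is the fractional part of $x$), and let $\mathcal{O}_Q(x)=(T_{Q,n}(x))_{n=0}^\infty$. For an interval $I\subseteq[0,1]$ and a sequence $\omega=(x_i)_{i\ge 0}$ in $[0,1)$ put $A_n(I,\omega)=\#\{i\le n: x_i\in I\}$. Let $I,J\subseteq[0,1]$ be disjoint non-degenerate intervals (open, closed or half-open) with $\lambda(I)+\lambda(J)<1$, where $\lambda$ is Lebesgue measure, and let $f,g:[0,1]\to\mathbb{R}$ be arbitrary functions such that $f(x_0)=g(x_0)$ for some $x_0\in[0,1/2]$. Then the set of all $x\in[0,1)$ such that both limits $\lim_{n\to\infty}\frac{A_n(I,\mathcal{O}_Q(x))}{n}$ and $\lim_{n\to\infty}\frac{A_n(J,\mathcal{O}_Q(x))}{n}$ exist and $$f\left(\lim_{n\to\infty}\frac{A_n(I,\mathcal{O}_Q(x))}{n}\right)=g\left(\lim_{n\to\infty}\frac{A_n(J,\mathcal{O}_Q(x))}{n}\right)$$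 has Hausdorff dimension $1$. -/

import Mathlib

open Filter Topology

namespace CantorSeries

/-- A basic sequence `Q = (q_n)_{n ≥ 1}` consists of integers `q_n ≥ 2`.
The value `q 0` is never used. -/
def IsBasicSequence (q : ℕ → ℕ) : Prop :=
  ∀ n, 1 ≤ n → 2 ≤ q n

/-- `Q` is infinite in limit if `q_n → ∞`. -/
def InfiniteInLimit (q : ℕ → ℕ) : Prop :=
  Tendsto q atTop atTop

/-- `T_{Q,n}(x) = q_n q_{n-1} ⋯ q_1 x (mod 1)`, an element of `[0,1)`. -/
noncomputable def T (q : ℕ → ℕ) (n : ℕ) (x : ℝ) : ℝ :=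
  Int.fract ((∏ i ∈ Finset.Icc 1 n, (q i : ℝ)) * x)

/-- The counting function `A_n(I, ω) = #{i ≤ n : ω_i ∈ I}` of a sequence `(ω_i)_{i ≥ 0}`. -/
noncomputable def A (n : ℕ) (I : Set ℝ) (ω : ℕ → ℝ) : ℕ :=
  Set.ncard {i : ℕ | i ≤ n ∧ ω i ∈ I}

/-- `lim_{n → ∞} A_n(I, ω) / n` exists and equals `a`. -/
def HasFrequency (I : Set ℝ) (ω : ℕ → ℝ) (a : ℝ) : Prop :=
  Tendsto (fun n : ℕ => (A n I ω : ℝ) / (n : ℝ)) atTop (𝓝 a)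

end CantorSeries

open scoped NNReal ENNReal

namespace CantorSeries

/-! It suffices to make both frequencies equal to `x₀`. As `x₀ ≤ 1/2`, there are disjoint sets `U`,
`V` of positions, both of density `x₀`: the jumps of `⌊i x₀⌋` and of `⌊i x₀ + 1/2⌋`
(`disjoint_jumpSet`). One asks that, from some index on, `T_{Q,i}(x)` lie in a fixed closed interval
inside `I` for `i ∈ U`, inside `J` for `i ∈ V`, and off `I ∪ J` otherwise.

Such a restriction keeps a fixed proportion of the digits at each late position. Since the bases
tend to infinity, the loss is smaller than any power of their product, so full dimension survives
(`exists_dimH_tail_mem`). The proof maps `[0,1)` onto the restricted set digit by digit, with an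
inverse that is Hölder of every exponent `s < 1` (`one_le_dimH_image_transfer`). -/

/-! ### Cantor series, their tails, and the orbit of `T`. -/

/-- The real number `∑ e_j / (p_0 ⋯ p_j)` with Cantor digits `e` in the bases `p`. -/
noncomputable def digitSum (p e : ℕ → ℕ) : ℝ :=
  ∑' j, (e j : ℝ) / ∏ i ∈ Finset.range (j + 1), (p i : ℝ)

/-- The number whose digits are those of `digitSum p e` from position `n` on. -/
noncomputable def tail (p e : ℕ → ℕ) (n : ℕ) : ℝ :=
  digitSum (fun i => p (i + n)) (fun i => e (i + n))

lemma prod_base_pos {p : ℕ → ℕ} (hp : ∀ i, 1 ≤ p i) (n : ℕ) :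
    0 < ∏ i ∈ Finset.range n, (p i : ℝ) :=
  Finset.prod_pos fun i _ => by exact_mod_cast hp i

/-- As `e n ≤ p n - 1`, each term is at most a difference of consecutive reciprocal products, and
these telescope. -/
lemma sum_digits_le {p e : ℕ → ℕ} (hp : ∀ i, 1 ≤ p i) (he : ∀ i, e i + 1 ≤ p i) (n : ℕ) :
    ∑ j ∈ Finset.range n, (e j : ℝ) / ∏ i ∈ Finset.range (j + 1), (p i : ℝ)
      ≤ 1 - 1 / ∏ i ∈ Finset.range n, (p i : ℝ) := by
  induction n with
  | zero => simp
  | succ n ih =>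
    rw [Finset.sum_range_succ]
    have h1 := prod_base_pos hp n
    have h2 : (0 : ℝ) < p n := by exact_mod_cast hp n
    have h3 : (e n : ℝ) + 1 ≤ p n := by exact_mod_cast he n
    have h4 : (e n : ℝ) / ∏ i ∈ Finset.range (n + 1), (p i : ℝ)
        ≤ 1 / (∏ i ∈ Finset.range n, (p i : ℝ)) - 1 / ∏ i ∈ Finset.range (n + 1), (p i : ℝ) := by
      rw [Finset.prod_range_succ, div_sub_div _ _ h1.ne' (mul_pos h1 h2).ne',
        div_le_div_iff₀ (mul_pos h1 h2) (mul_pos h1 (mul_pos h1 h2))]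
      have := mul_le_mul_of_nonneg_left h3
        (mul_pos h1 (mul_pos h1 h2)).le
      nlinarith
    linarith

lemma digit_term_nonneg (p e : ℕ → ℕ) (j : ℕ) :
    0 ≤ (e j : ℝ) / ∏ i ∈ Finset.range (j + 1), (p i : ℝ) := by positivity

lemma summable_digits {p e : ℕ → ℕ} (hp : ∀ i, 1 ≤ p i) (he : ∀ i, e i + 1 ≤ p i) :
    Summable fun j => (e j : ℝ) / ∏ i ∈ Finset.range (j + 1), (p i : ℝ) := by
  refine summable_of_sum_range_le (c := 1) (digit_term_nonneg p e) fun n => ?_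
  have := one_div_pos.2 (prod_base_pos hp n)
  linarith [sum_digits_le hp he n]

lemma digitSum_nonneg (p e : ℕ → ℕ) : 0 ≤ digitSum p e :=
  tsum_nonneg (digit_term_nonneg p e)

lemma digitSum_le_one {p e : ℕ → ℕ} (hp : ∀ i, 1 ≤ p i) (he : ∀ i, e i + 1 ≤ p i) :
    digitSum p e ≤ 1 := by
  refine Real.tsum_le_of_sum_range_le (digit_term_nonneg p e) fun n => ?_
  have := one_div_pos.2 (prod_base_pos hp n)
  linarith [sum_digits_le hp he n]

lemma mul_digitSum {p e : ℕ → ℕ} (hp : ∀ i, 1 ≤ p i) (he : ∀ i, e i + 1 ≤ p i) :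
    (p 0 : ℝ) * digitSum p e
      = e 0 + digitSum (fun i => p (i + 1)) (fun i => e (i + 1)) := by
  have h0 : (p 0 : ℝ) ≠ 0 := by exact_mod_cast (Nat.one_le_iff_ne_zero.1 (hp 0))
  unfold digitSum
  rw [(summable_digits hp he).tsum_eq_zero_add, mul_add, ← tsum_mul_left]
  congr 1
  · simp; field_simp
  · refine tsum_congr fun j => ?_
    rw [Finset.prod_range_succ' _ (j + 1)]
    field_simp

lemma tail_zero (p e : ℕ → ℕ) : tail p e 0 = digitSum p e := rfl

lemma mul_tail {p e : ℕ → ℕ} (hp : ∀ i, 1 ≤ p i) (he : ∀ i, e i + 1 ≤ p i) (n : ℕ) :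
    (p n : ℝ) * tail p e n = e n + tail p e (n + 1) := by
  have := mul_digitSum (p := fun i => p (i + n)) (e := fun i => e (i + n))
    (fun i => hp _) (fun i => he _)
  simpa [tail, add_assoc, add_comm, add_left_comm] using this

lemma tail_nonneg (p e : ℕ → ℕ) (n : ℕ) : 0 ≤ tail p e n := digitSum_nonneg _ _

/-- Avoiding the top digit gives `p n * tail ≤ e n + 1 < p n`; this rules out the expansions that
sum to 1. -/
lemma tail_lt_one {p e : ℕ → ℕ} (he : ∀ i, e i + 2 ≤ p i) (n : ℕ) : tail p e n < 1 := by
  have hp : ∀ i, 1 ≤ p i := fun i => by have := he i; omega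
  have he' : ∀ i, e i + 1 ≤ p i := fun i => by have := he i; omega
  have h1 := mul_tail hp he' n
  have h2 : tail p e (n + 1) ≤ 1 := digitSum_le_one (fun i => hp _) (fun i => he' _)
  have h3 : (e n : ℝ) + 2 ≤ p n := by exact_mod_cast he n
  have h4 : (0 : ℝ) < p n := by exact_mod_cast hp n
  by_contra! h
  nlinarith

lemma prod_mul_digitSum {p e : ℕ → ℕ} (hp : ∀ i, 1 ≤ p i) (he : ∀ i, e i + 1 ≤ p i) (n : ℕ) :
    ∃ z : ℤ, (∏ i ∈ Finset.range n, (p i : ℝ)) * digitSum p e = z + tail p e n := by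
  induction n with
  | zero => exact ⟨0, by simp [tail_zero]⟩
  | succ n ih =>
    obtain ⟨z, hz⟩ := ih
    refine ⟨p n * z + e n, ?_⟩
    rw [Finset.prod_range_succ, mul_right_comm, hz]
    push_cast
    linear_combination mul_tail hp he n

lemma T_digitSum {q e : ℕ → ℕ} (he : ∀ i, e i + 2 ≤ q (i + 1)) (n : ℕ) :
    T q n (digitSum (fun i => q (i + 1)) e) = tail (fun i => q (i + 1)) e n := by
  obtain ⟨z, hz⟩ := prod_mul_digitSum (p := fun i => q (i + 1)) (e := e)
    (fun i => by have := he i; omega) (fun i => by have := he i; omega) n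
  have h : ∏ i ∈ Finset.Icc 1 n, (q i : ℝ) = ∏ i ∈ Finset.range n, (q (i + 1) : ℝ) := by
    rw [← Finset.Ico_add_one_right_eq_Icc, Finset.prod_Ico_eq_prod_range]
    simp [add_comm]
  rw [T, h, hz, Int.fract_intCast_add, Int.fract_eq_self]
  exact ⟨tail_nonneg _ _ _, tail_lt_one he n⟩

lemma prod_mul_digitSum_sub {p e e' : ℕ → ℕ} (hp : ∀ i, 1 ≤ p i)
    (he : ∀ i, e i + 1 ≤ p i) (he' : ∀ i, e' i + 1 ≤ p i) (n : ℕ) (h : ∀ i < n, e i = e' i) :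
    (∏ i ∈ Finset.range n, (p i : ℝ)) * (digitSum p e - digitSum p e')
      = tail p e n - tail p e' n := by
  induction n with
  | zero => simp [tail_zero]
  | succ n ih =>
    have h1 := ih fun i hi => h i (by omega)
    rw [Finset.prod_range_succ, mul_right_comm, h1]
    have h2 := mul_tail hp he n
    have h3 := mul_tail hp he' n
    rw [h n (by omega)] at h2
    linear_combination h2 - h3

/-! ### Cantor digits of a real number. -/

/-- The `i`-th Cantor digit of `y` in the bases `M`. -/
noncomputable def digit (M : ℕ → ℕ) (y : ℝ) (i : ℕ) : ℕ :=
  ⌊(M i : ℝ) * Int.fract ((∏ j ∈ Finset.range i, (M j : ℝ)) * y)⌋₊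

lemma digit_lt {M : ℕ → ℕ} (hM : ∀ i, 1 ≤ M i) (y : ℝ) (i : ℕ) : digit M y i < M i := by
  have h : (0 : ℝ) < M i := by exact_mod_cast hM i
  rw [digit, Nat.floor_lt (by positivity)]
  nlinarith [Int.fract_lt_one ((∏ j ∈ Finset.range i, (M j : ℝ)) * y)]

lemma mul_fract_prod {M : ℕ → ℕ} (y : ℝ) (i : ℕ) :
    (M i : ℝ) * Int.fract ((∏ j ∈ Finset.range i, (M j : ℝ)) * y)
      = digit M y i + Int.fract ((∏ j ∈ Finset.range (i + 1), (M j : ℝ)) * y) := by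
  set u := (∏ j ∈ Finset.range i, (M j : ℝ)) * y with hu
  have h1 : (∏ j ∈ Finset.range (i + 1), (M j : ℝ)) * y
      = ((M i * ⌊u⌋ : ℤ) : ℝ) + M i * Int.fract u := by
    rw [Finset.prod_range_succ]
    push_cast
    rw [Int.fract, hu]
    ring
  have h0 : 0 ≤ (M i : ℝ) * Int.fract u := by positivity
  rw [h1, Int.fract_intCast_add, digit, ← hu, natCast_floor_eq_intCast_floor h0,
    Int.floor_add_fract]

lemma prod_mul_sub_eq {M : ℕ → ℕ} {y y' : ℝ}
    (hy : y ∈ Set.Ico (0 : ℝ) 1) (hy' : y' ∈ Set.Ico (0 : ℝ) 1) (n : ℕ)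
    (h : ∀ i < n, digit M y i = digit M y' i) :
    (∏ i ∈ Finset.range n, (M i : ℝ)) * (y - y')
      = Int.fract ((∏ i ∈ Finset.range n, (M i : ℝ)) * y)
        - Int.fract ((∏ i ∈ Finset.range n, (M i : ℝ)) * y') := by
  induction n with
  | zero => simp [Int.fract_eq_self.2 hy, Int.fract_eq_self.2 hy']
  | succ n ih =>
    have h1 := ih fun i hi => h i (by omega)
    have h2 := mul_fract_prod (M := M) y n
    have h3 := mul_fract_prod (M := M) y' n
    rw [h n (by omega)] at h2
    have h4 : (∏ i ∈ Finset.range (n + 1), (M i : ℝ)) * (y - y')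
        = M n * ((∏ i ∈ Finset.range n, (M i : ℝ)) * (y - y')) := by
      rw [Finset.prod_range_succ]; ring
    rw [h4, h1]
    linear_combination h2 - h3

lemma exists_first_digit_ne {M : ℕ → ℕ}
    (hMt : Tendsto (fun n => ∏ i ∈ Finset.range n, (M i : ℝ)) atTop atTop) {y y' : ℝ}
    (hy : y ∈ Set.Ico (0 : ℝ) 1) (hy' : y' ∈ Set.Ico (0 : ℝ) 1) (hne : y ≠ y') :
    ∃ n, digit M y n ≠ digit M y' n ∧ ∀ i < n, digit M y i = digit M y' i := by
  have hex : ∃ n, digit M y n ≠ digit M y' n := by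
    by_contra! h
    have hpos : 0 < |y - y'| := abs_pos.2 (sub_ne_zero.2 hne)
    obtain ⟨n, hn⟩ := (hMt.eventually_ge_atTop (1 / |y - y'|)).exists
    have h1 := prod_mul_sub_eq hy hy' n fun i _ => h i
    have h2 : |(∏ i ∈ Finset.range n, (M i : ℝ)) * (y - y')| < 1 := by
      rw [h1]
      exact Int.abs_sub_lt_one_of_floor_eq_floor (by simp)
    rw [abs_mul, abs_of_nonneg (by positivity)] at h2
    rw [div_le_iff₀ hpos] at hn
    linarith
  classical
  exact ⟨Nat.find hex, Nat.find_spec hex, fun i hi => not_not.1 (Nat.find_min hex hi)⟩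

/-! ### The digit transfer map and its Hölder inverse. -/

/-- Translated digits: `y` is sent to the number whose digits in the bases `p` are those of `y`
in the bases `M`, translated by `d`. -/
noncomputable def transfer (p M d : ℕ → ℕ) (y : ℝ) : ℝ :=
  digitSum p fun i => d i + digit M y i

/-- Let `n` be the first differing position and `m` the digit difference there. The sources differ
by at most `m + 1 ≤ 2m` units of level `n + 1`. The images differ by at least `m - 1/2 ≥ m/2` such
units, because `htail` keeps the remaining tails within `1/2`. -/
lemma abs_sub_le_and_le_transfer {p M d : ℕ → ℕ} (hM : ∀ i, 1 ≤ M i)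
    (hd : ∀ i, d i + M i < p i)
    (hMt : Tendsto (fun n => ∏ i ∈ Finset.range n, (M i : ℝ)) atTop atTop)
    (htail : ∀ n, 2 ≤ M n → ∀ y y' : ℝ,
      |tail p (fun i => d i + digit M y i) (n + 1) - tail p (fun i => d i + digit M y' i) (n + 1)|
        ≤ 1 / 2)
    {y y' : ℝ} (hy : y ∈ Set.Ico (0 : ℝ) 1) (hy' : y' ∈ Set.Ico (0 : ℝ) 1) (hne : y ≠ y') :
    ∃ (n : ℕ) (m : ℝ), 1 ≤ m ∧ m ≤ p n ∧
      |y - y'| ≤ 2 * m / ∏ i ∈ Finset.range (n + 1), (M i : ℝ) ∧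
      m / ∏ i ∈ Finset.range (n + 1), (p i : ℝ) ≤ 2 * |transfer p M d y - transfer p M d y'| := by
  obtain ⟨n, hn, hlt⟩ := exists_first_digit_ne hMt hy hy' hne
  have hp : ∀ i, 1 ≤ p i := fun i => by have := hd i; omega
  have hk := digit_lt hM y
  have hk' := digit_lt hM y'
  have he : ∀ i, (d i + digit M y i) + 1 ≤ p i := fun i => by
    have := hd i; have := hk i; omega
  have he' : ∀ i, (d i + digit M y' i) + 1 ≤ p i := fun i => by
    have := hd i; have := hk' i; omega
  have hm1 : (1 : ℝ) ≤ |(digit M y n : ℝ) - digit M y' n| := by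
    have : (1 : ℤ) ≤ |(digit M y n : ℤ) - digit M y' n| :=
      Int.one_le_abs (sub_ne_zero.2 (by exact_mod_cast hn))
    exact_mod_cast this
  have hMn : 2 ≤ M n := by have := hk n; have := hk' n; omega
  refine ⟨n, |(digit M y n : ℝ) - digit M y' n|, hm1, ?_, ?_, ?_⟩
  · have h1 : (digit M y n : ℝ) ≤ p n := by exact_mod_cast (by have := he n; omega)
    have h2 : (digit M y' n : ℝ) ≤ p n := by exact_mod_cast (by have := he' n; omega)
    rw [abs_le]
    constructor <;> linarith [Nat.cast_nonneg (α := ℝ) (digit M y n),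
      Nat.cast_nonneg (α := ℝ) (digit M y' n)]
  · rw [le_div_iff₀ (prod_base_pos hM _)]
    have h1 := prod_mul_sub_eq hy hy' n hlt
    have h2 := mul_fract_prod (M := M) y n
    have h3 := mul_fract_prod (M := M) y' n
    set s := Int.fract ((∏ j ∈ Finset.range (n + 1), (M j : ℝ)) * y)
    set s' := Int.fract ((∏ j ∈ Finset.range (n + 1), (M j : ℝ)) * y')
    have h4 : (y - y') * ∏ i ∈ Finset.range (n + 1), (M i : ℝ)
        = ((digit M y n : ℝ) - digit M y' n) + (s - s') := by
      rw [Finset.prod_range_succ]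
      linear_combination (M n : ℝ) * h1 + h2 - h3
    have h5 : |s - s'| < 1 := Int.abs_sub_lt_one_of_floor_eq_floor (by simp [s, s'])
    rw [← abs_of_pos (prod_base_pos hM (n + 1)), ← abs_mul, h4]
    linarith [abs_add_le ((digit M y n : ℝ) - digit M y' n) (s - s')]
  · rw [div_le_iff₀ (prod_base_pos hp _)]
    have h1 := prod_mul_digitSum_sub hp he he' n fun i hi => by rw [hlt i hi]
    have h2 := mul_tail hp he n
    have h3 := mul_tail hp he' n
    have h5 := htail n hMn y y'
    set s := tail p (fun i => d i + digit M y i) (n + 1)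
    set s' := tail p (fun i => d i + digit M y' i) (n + 1)
    have h4 : (transfer p M d y - transfer p M d y') * ∏ i ∈ Finset.range (n + 1), (p i : ℝ)
        = ((digit M y n : ℝ) - digit M y' n) + (s - s') := by
      rw [Finset.prod_range_succ, transfer, transfer]
      push_cast at h2 h3
      linear_combination (p n : ℝ) * h1 + h2 - h3
    rw [← abs_of_pos (prod_base_pos hp (n + 1)), mul_assoc, ← abs_mul, h4]
    have := abs_sub_abs_le_abs_sub ((digit M y n : ℝ) - digit M y' n) (-(s - s'))
    rw [abs_neg, sub_neg_eq_add] at this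
    linarith

lemma one_le_dimH_image_transfer {p M d : ℕ → ℕ} (hM : ∀ i, 1 ≤ M i)
    (hd : ∀ i, d i + M i < p i)
    (hMt : Tendsto (fun n => ∏ i ∈ Finset.range n, (M i : ℝ)) atTop atTop)
    (htail : ∀ n, 2 ≤ M n → ∀ y y' : ℝ,
      |tail p (fun i => d i + digit M y i) (n + 1) - tail p (fun i => d i + digit M y' i) (n + 1)|
        ≤ 1 / 2)
    (hgrowth : ∀ ε : ℝ, 0 < ε → ∃ C : ℝ, ∀ n,
      (∏ i ∈ Finset.range (n + 1), (p i : ℝ)) / ∏ i ∈ Finset.range (n + 1), (M i : ℝ)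
        ≤ C * (∏ i ∈ Finset.range n, (p i : ℝ)) ^ ε) :
    1 ≤ dimH (transfer p M d '' Set.Ico 0 1) := by
  have hp : ∀ i, 1 ≤ p i := fun i => by have := hd i; omega
  refine le_of_forall_lt_imp_le_of_dense fun s hs => ?_
  obtain rfl | hs0 := eq_or_ne s 0
  · exact zero_le
  lift s to ℝ≥0 using (hs.trans ENNReal.one_lt_top).ne
  have hs1 : (s : ℝ) < 1 := by exact_mod_cast hs
  have hs0' : 0 < s := pos_iff_ne_zero.2 (by simpa using hs0)
  obtain ⟨C, hC⟩ := hgrowth (1 - s) (by linarith)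
  have hC0 : 0 ≤ C := by
    have h := hC 0
    simp only [Finset.range_zero, Finset.prod_empty, Real.one_rpow, mul_one] at h
    exact le_trans (by positivity) h
  have key : ∀ y ∈ Set.Ico (0 : ℝ) 1, ∀ y' ∈ Set.Ico (0 : ℝ) 1,
      |y - y'| ≤ 4 * C * |transfer p M d y - transfer p M d y'| ^ (s : ℝ) := by
    intro y hy y' hy'
    obtain rfl | hne := eq_or_ne y y'
    · rw [sub_self, abs_zero]; positivity
    obtain ⟨n, m, hm1, hmp, h1, h2⟩ := abs_sub_le_and_le_transfer hM hd hMt htail hy hy' hne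
    have hP := prod_base_pos hp n
    have hP' := prod_base_pos hp (n + 1)
    have hY := prod_base_pos hM (n + 1)
    have hC' := hC n
    set P := ∏ i ∈ Finset.range n, (p i : ℝ)
    set P' := ∏ i ∈ Finset.range (n + 1), (p i : ℝ) with hP'_def
    set Y := ∏ i ∈ Finset.range (n + 1), (M i : ℝ)
    set r := |transfer p M d y - transfer p M d y'|
    have hm0 : 0 < m := by linarith
    -- Keeping `m` instead of bounding it by 1 pays here: `hgrowth` involves only the first `n`
    -- bases, and `m ≤ p n` compensates for the last one.
    have hPm : P ≤ P' / m := by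
      rw [le_div_iff₀ hm0, hP'_def, Finset.prod_range_succ]
      exact mul_le_mul_of_nonneg_left hmp hP.le
    calc |y - y'| ≤ 2 * m / Y := h1
      _ = 2 * (m / P') * (P' / Y) := by field_simp
      _ ≤ 2 * (m / P') * (C * (P' / m) ^ (1 - s : ℝ)) := by
          gcongr
          refine hC'.trans ?_
          gcongr
      _ = 2 * C * (m / P') ^ (s : ℝ) := by
          have h3 : (P' / m) ^ (1 - s : ℝ) = (m / P') ^ (s : ℝ) / (m / P') := by
            rw [← inv_div m P', Real.inv_rpow (by positivity),
              Real.rpow_sub (by positivity), Real.rpow_one, inv_div]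
          rw [h3]; field_simp
      _ ≤ 2 * C * (2 * r) ^ (s : ℝ) := by gcongr
      _ ≤ 2 * C * (2 * r ^ (s : ℝ)) := by
          rw [Real.mul_rpow (by norm_num) (abs_nonneg _)]
          gcongr
          exact (Real.rpow_le_rpow_of_exponent_le one_le_two hs1.le).trans_eq (Real.rpow_one 2)
      _ = 4 * C * r ^ (s : ℝ) := by ring
  have hinj : Set.InjOn (transfer p M d) (Set.Ico 0 1) := fun y hy y' hy' h => by
    have := key y hy y' hy'
    rw [h, sub_self, abs_zero, Real.zero_rpow (by exact_mod_cast hs0'.ne'), mul_zero] at this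
    exact sub_eq_zero.1 (abs_nonpos_iff.1 this)
  have hleft := hinj.leftInvOn_invFunOn
  have hold : HolderOnWith (4 * C).toNNReal s
      (Function.invFunOn (transfer p M d) (Set.Ico 0 1)) (transfer p M d '' Set.Ico 0 1) := by
    rintro _ ⟨y, hy, rfl⟩ _ ⟨y', hy', rfl⟩
    rw [hleft hy, hleft hy', edist_dist, edist_dist,
      ENNReal.ofReal_rpow_of_nonneg dist_nonneg s.coe_nonneg]
    change _ ≤ ENNReal.ofReal (4 * C) * _
    rw [← ENNReal.ofReal_mul (by positivity), Real.dist_eq, Real.dist_eq]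
    exact ENNReal.ofReal_le_ofReal (key y hy y' hy')
  -- The inverse maps onto `[0,1)`, of dimension 1, so `1 ≤ dimH / s`.
  have h := hold.dimH_image_le hs0'
  rw [hleft.image_image, Real.dimH_of_nonempty_interior (by simp), Module.finrank_self,
    Nat.cast_one, ENNReal.le_div_iff_mul_le (by simp [hs0'.ne']) (by simp), one_mul] at h
  exact h

/-! ### Growth of the products of the bases. -/

/-- Passing from `n` to `n + 1` multiplies the normalised ratio `R` by `p (n+1) / M (n+1) / p n ^
ε`, which is at most 1 once `p n ^ ε ≥ c⁻¹`. So `R` is eventually nonincreasing, hence bounded. -/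
lemma prod_div_prod_le_rpow {p M : ℕ → ℕ} (hp : ∀ i, 1 ≤ p i) (hM : ∀ i, 1 ≤ M i)
    (hpt : Tendsto p atTop atTop) {c : ℝ} (hc : 0 < c) (hcM : ∀ᶠ i in atTop, c * p i ≤ M i)
    {ε : ℝ} (hε : 0 < ε) :
    ∃ C : ℝ, ∀ n,
      (∏ i ∈ Finset.range (n + 1), (p i : ℝ)) / ∏ i ∈ Finset.range (n + 1), (M i : ℝ)
        ≤ C * (∏ i ∈ Finset.range n, (p i : ℝ)) ^ ε := by
  set R : ℕ → ℝ := fun n =>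
    (∏ i ∈ Finset.range (n + 1), (p i : ℝ)) / (∏ i ∈ Finset.range (n + 1), (M i : ℝ))
      / (∏ i ∈ Finset.range n, (p i : ℝ)) ^ ε with hR
  have hlarge : ∀ᶠ n in atTop, c⁻¹ ≤ (p n : ℝ) ^ ε :=
    ((tendsto_rpow_atTop hε).comp
      (tendsto_natCast_atTop_atTop.comp hpt)).eventually_ge_atTop c⁻¹
  obtain ⟨N, hN⟩ := eventually_atTop.1 (hlarge.and hcM)
  have hstep : ∀ n ≥ N, R (n + 1) ≤ R n := by
    intro n hn
    have h1 := (hN n hn).1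
    have h2 := (hN (n + 1) (by omega)).2
    have hP := prod_base_pos hp n
    have hP' := prod_base_pos hp (n + 1)
    have hY := prod_base_pos hM (n + 1)
    have hpn : (0 : ℝ) < p n := by exact_mod_cast hp n
    have hpn1 : (0 : ℝ) < p (n + 1) := by exact_mod_cast hp (n + 1)
    have hMn : (0 : ℝ) < M (n + 1) := by exact_mod_cast hM (n + 1)
    have hfac : R (n + 1) = R n * ((p (n + 1) : ℝ) / M (n + 1) / (p n : ℝ) ^ ε) := by
      simp only [hR]
      rw [Finset.prod_range_succ _ (n + 1), Finset.prod_range_succ (fun i => (M i : ℝ)) (n + 1)]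
      rw [show (∏ i ∈ Finset.range (n + 1), (p i : ℝ)) ^ ε
        = (∏ i ∈ Finset.range n, (p i : ℝ)) ^ ε * (p n : ℝ) ^ ε by
          rw [Finset.prod_range_succ, Real.mul_rpow hP.le hpn.le]]
      field_simp
    have hR0 : 0 ≤ R n := by simp only [hR]; positivity
    rw [hfac]
    refine mul_le_of_le_one_right hR0 ?_
    rw [div_le_one (by positivity)]
    refine le_trans ?_ h1
    rw [div_le_iff₀ hMn, inv_mul_eq_div, le_div_iff₀ hc]
    linarith
  have hbd : BddAbove (Set.range R) := by
    refine Filter.IsBoundedUnder.bddAbove_range ⟨R N, ?_⟩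
    rw [eventually_map]
    filter_upwards [eventually_ge_atTop N] with n hn
    induction n, hn using Nat.le_induction with
    | base => exact le_rfl
    | succ n hn ih => exact (hstep n hn).trans ih
  obtain ⟨C, hC⟩ := hbd
  refine ⟨C, fun n => ?_⟩
  have hP := prod_base_pos hp n
  have := hC ⟨n, rfl⟩
  rwa [hR, div_le_iff₀ (by positivity)] at this

lemma tendsto_prod_atTop {M : ℕ → ℕ} (hM : ∀ i, 1 ≤ M i) (hM2 : ∀ᶠ i in atTop, 2 ≤ M i) :
    Tendsto (fun n => ∏ i ∈ Finset.range n, (M i : ℝ)) atTop atTop := by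
  obtain ⟨N, hN⟩ := eventually_atTop.1 hM2
  rw [← tendsto_add_atTop_iff_nat N]
  refine tendsto_atTop_mono (fun n => ?_) (tendsto_pow_atTop_atTop_of_one_lt (one_lt_two (α := ℝ)))
  induction n with
  | zero =>
    have : 1 ≤ ∏ i ∈ Finset.range N, M i := Finset.one_le_prod' fun i _ => hM i
    simpa using (by exact_mod_cast this : (1 : ℝ) ≤ ∏ i ∈ Finset.range N, (M i : ℝ))
  | succ n ih =>
    rw [show n + 1 + N = (n + N) + 1 by ring, Finset.prod_range_succ, pow_succ]
    have h2 : (2 : ℝ) ≤ M (n + N) := by exact_mod_cast hN (n + N) (by omega)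
    gcongr

/-! ### Prescribing intervals for the tails. -/

lemma tail_mem_Icc {p e : ℕ → ℕ} (he : ∀ i, e i + 2 ≤ p i) {n : ℕ} {α β : ℝ}
    (hα : α * p n ≤ e n) (hβ : (e n : ℝ) + 1 ≤ β * p n) : tail p e n ∈ Set.Icc α β := by
  have h1 := mul_tail (p := p) (e := e) (fun i => by have := he i; omega)
    (fun i => by have := he i; omega) n
  have h2 := tail_nonneg p e (n + 1)
  have h3 := tail_lt_one he (n + 1)
  have h4 : (0 : ℝ) < p n := by exact_mod_cast (by have := he n; omega : 0 < p n)
  constructor <;> nlinarith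

/-- For bases tending to infinity, prescribing from some point on an interval of length at least
`δ` for each tail leaves a set of full Hausdorff dimension. -/
theorem exists_dimH_tail_mem {p : ℕ → ℕ} (hp : ∀ i, 2 ≤ p i) (hpt : Tendsto p atTop atTop)
    {α β : ℕ → ℝ} {δ : ℝ} (hδ : 0 < δ) (hα : ∀ i, 0 ≤ α i) (hαβ : ∀ i, α i + δ ≤ β i)
    (hβ : ∀ i, β i < 1) (hlen : ∀ i, β i - α i ≤ 1 / 2) :
    ∃ (E : Set ℝ) (n₀ : ℕ), 1 ≤ dimH E ∧ ∀ x ∈ E, ∃ e : ℕ → ℕ, (∀ i, e i + 2 ≤ p i) ∧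
      x = digitSum p e ∧ ∀ i ≥ n₀, tail p e i ∈ Set.Icc (α i) (β i) := by
  -- Rounding both endpoints costs fewer than 2 digits, so `δ * p i ≥ 8` amply leaves `M i ≥ δ / 2 *
  -- p i` and `M i ≥ 2`.
  obtain ⟨n₀, hn₀⟩ := eventually_atTop.1
    ((tendsto_natCast_atTop_atTop (R := ℝ)).comp hpt |>.eventually_ge_atTop (8 / δ))
  have hp8 : ∀ i ≥ n₀, 8 ≤ δ * p i := fun i hi => by
    have := hn₀ i hi
    rw [Function.comp_apply, div_le_iff₀ hδ] at this
    linarith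
  set d : ℕ → ℕ := fun i => if n₀ ≤ i then ⌈α i * p i⌉₊ else 0 with hd_def
  -- The admissible digits are `d i, ..., d i + M i - 1`; before `n₀` only the digit 0 is used.
  set M : ℕ → ℕ := fun i => if n₀ ≤ i then ⌊β i * p i⌋₊ - ⌈α i * p i⌉₊ else 1 with hM_def
  have hd : ∀ i ≥ n₀, α i * p i ≤ d i := fun i hi => by
    simp only [hd_def, if_pos hi]; exact Nat.le_ceil _
  have hlarge : ∀ i ≥ n₀, d i + M i = ⌊β i * p i⌋₊ ∧ δ / 2 * p i ≤ M i := fun i hi => by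
    have hp0 : (0 : ℝ) ≤ p i := Nat.cast_nonneg _
    have h1 := Nat.ceil_lt_add_one (mul_nonneg (hα i) hp0)
    have h2 := Nat.lt_floor_add_one (β i * p i)
    have h3 := mul_le_mul_of_nonneg_right (hαβ i) hp0
    have h4 := hp8 i hi
    have h5 : ⌈α i * p i⌉₊ ≤ ⌊β i * p i⌋₊ := by
      have : (⌈α i * p i⌉₊ : ℝ) ≤ ⌊β i * p i⌋₊ := by linarith
      exact_mod_cast this
    simp only [hd_def, hM_def, if_pos hi]
    refine ⟨by omega, ?_⟩
    rw [Nat.cast_sub h5]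
    linarith
  have hdM : ∀ i ≥ n₀, ((d i + M i : ℕ) : ℝ) ≤ β i * p i := fun i hi => by
    rw [(hlarge i hi).1]
    have := hαβ i
    have := hα i
    exact Nat.floor_le (mul_nonneg (by linarith) (Nat.cast_nonneg _))
  have hM2 : ∀ i ≥ n₀, 2 ≤ M i := fun i hi => by
    have : (2 : ℝ) ≤ M i := by linarith [(hlarge i hi).2, hp8 i hi]
    exact_mod_cast this
  have hsmall : ∀ i < n₀, d i = 0 ∧ M i = 1 := fun i hi => by
    simp only [hd_def, hM_def, if_neg (not_le.2 hi), and_self]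
  have hM : ∀ i, 1 ≤ M i := fun i => by
    rcases le_or_gt n₀ i with hi | hi
    · have := hM2 i hi; omega
    · rw [(hsmall i hi).2]
  have hdMp : ∀ i, d i + M i < p i := fun i => by
    rcases le_or_gt n₀ i with hi | hi
    · have h0 : (0 : ℝ) < p i := by exact_mod_cast (by have := hp i; omega : 0 < p i)
      have : ((d i + M i : ℕ) : ℝ) < p i := (hdM i hi).trans_lt (by nlinarith [hβ i])
      exact_mod_cast this
    · rw [(hsmall i hi).1, (hsmall i hi).2]; have := hp i; omega
  have he : ∀ y i, (d i + digit M y i) + 2 ≤ p i := fun y i => by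
    have := hdMp i; have := digit_lt hM y i; omega
  have hmem : ∀ y, ∀ i ≥ n₀, tail p (fun i => d i + digit M y i) i ∈ Set.Icc (α i) (β i) := by
    intro y i hi
    refine tail_mem_Icc (he y) ?_ ?_
    · push_cast
      exact (hd i hi).trans (le_add_of_nonneg_right (Nat.cast_nonneg _))
    · refine le_trans ?_ (hdM i hi)
      have := digit_lt hM y i
      exact_mod_cast (by omega : d i + digit M y i + 1 ≤ d i + M i)
  refine ⟨transfer p M d '' Set.Ico 0 1, n₀, ?_, ?_⟩
  · refine one_le_dimH_image_transfer hM hdMp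
      (tendsto_prod_atTop hM (eventually_atTop.2 ⟨n₀, hM2⟩)) (fun n hn y y' => ?_) fun ε hε =>
      prod_div_prod_le_rpow (fun i => by have := hp i; omega) hM hpt (half_pos hδ)
        (eventually_atTop.2 ⟨n₀, fun i hi => (hlarge i hi).2⟩) hε
    -- A free digit at `n` forces `n ≥ n₀`, so both tails at `n + 1` lie in one interval of length
    -- at most `1/2`.
    have hn' : n₀ ≤ n + 1 := by
      by_contra! h
      have := (hsmall n (by omega)).2
      omega
    have h1 := hmem y (n + 1) hn'
    have h2 := hmem y' (n + 1) hn'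
    have h3 := hlen (n + 1)
    rw [abs_le]
    constructor <;> linarith [h1.1, h1.2, h2.1, h2.2]
  · rintro _ ⟨y, -, rfl⟩
    exact ⟨_, he y, rfl, hmem y⟩

/-! ### Frequencies and sets of positions with prescribed density. -/

lemma tendsto_div_of_abs_sub_le {u : ℕ → ℝ} {x K : ℝ} (h : ∀ n : ℕ, |u n - n * x| ≤ K) :
    Tendsto (fun n : ℕ => u n / n) atTop (𝓝 x) := by
  rw [tendsto_iff_dist_tendsto_zero]
  refine squeeze_zero' (Eventually.of_forall fun _ => dist_nonneg) ?_
    (tendsto_const_div_atTop_nhds_zero_nat K)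
  filter_upwards [eventually_gt_atTop 0] with n hn
  have hn' : (0 : ℝ) < n := by exact_mod_cast hn
  rw [Real.dist_eq, show u n / n - x = (u n - n * x) / n by field_simp, abs_div,
    abs_of_pos hn']
  gcongr
  exact h n

lemma abs_ncard_sub_ncard_le {U V : Set ℕ} {n₀ : ℕ} (h : ∀ i ≥ n₀, i ∈ U ↔ i ∈ V) (n : ℕ) :
    |(Set.ncard {i | i ≤ n ∧ i ∈ U} : ℝ) - Set.ncard {i | i ≤ n ∧ i ∈ V}| ≤ n₀ := by
  have key : ∀ U V : Set ℕ, (∀ i ≥ n₀, i ∈ U ↔ i ∈ V) →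
      Set.ncard {i | i ≤ n ∧ i ∈ U} ≤ Set.ncard {i | i ≤ n ∧ i ∈ V} + n₀ := by
    intro U V h
    have hV : {i | i ≤ n ∧ i ∈ V}.Finite := (Set.finite_Iic n).subset fun i hi => hi.1
    calc Set.ncard {i | i ≤ n ∧ i ∈ U}
        ≤ Set.ncard ({i | i ≤ n ∧ i ∈ V} ∪ Set.Iio n₀) := by
          refine Set.ncard_le_ncard (fun i hi => ?_) (hV.union (Set.finite_Iio n₀))
          rcases le_or_gt n₀ i with h' | h'
          · exact Or.inl ⟨hi.1, (h i h').1 hi.2⟩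
          · exact Or.inr h'
      _ ≤ _ := Set.ncard_union_le _ _
      _ = _ := by rw [← Finset.coe_Iio, Set.ncard_coe_finset, Nat.card_Iio]
  have h1 := key U V h
  have h2 := key V U fun i hi => (h i hi).symm
  have h1' : (Set.ncard {i | i ≤ n ∧ i ∈ U} : ℝ) ≤ Set.ncard {i | i ≤ n ∧ i ∈ V} + n₀ := by
    exact_mod_cast h1
  have h2' : (Set.ncard {i | i ≤ n ∧ i ∈ V} : ℝ) ≤ Set.ncard {i | i ≤ n ∧ i ∈ U} + n₀ := by
    exact_mod_cast h2
  rw [abs_le]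
  constructor <;> linarith

/-- The positions at which the sequence `⌊i x + θ⌋` jumps. -/
def jumpSet (x θ : ℝ) : Set ℕ := {i | ⌊(i : ℝ) * x + θ⌋ ≠ ⌊((i : ℝ) + 1) * x + θ⌋}

/-- For `0 ≤ x ≤ 1` each increment of `⌊i x + θ⌋` is 0 or 1, so the count telescopes. -/
lemma ncard_jumpSet {x θ : ℝ} (hx0 : 0 ≤ x) (hx1 : x ≤ 1) (n : ℕ) :
    (Set.ncard {i | i ≤ n ∧ i ∈ jumpSet x θ} : ℤ) = ⌊((n : ℝ) + 1) * x + θ⌋ - ⌊θ⌋ := by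
  classical
  have h : {i | i ≤ n ∧ i ∈ jumpSet x θ}
      = ((Finset.range (n + 1)).filter (· ∈ jumpSet x θ) : Set ℕ) := by
    ext i; simp
  rw [h, Set.ncard_coe_finset, Finset.card_filter]
  have hstep : ∀ i : ℕ, ((if i ∈ jumpSet x θ then 1 else 0 : ℕ) : ℤ)
      = ⌊((i + 1 : ℕ) : ℝ) * x + θ⌋ - ⌊(i : ℝ) * x + θ⌋ := by
    intro i
    have h1 : ⌊(i : ℝ) * x + θ⌋ ≤ ⌊((i : ℝ) + 1) * x + θ⌋ := Int.floor_le_floor (by linarith)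
    have h2 : ⌊((i : ℝ) + 1) * x + θ⌋ ≤ ⌊(i : ℝ) * x + θ⌋ + 1 := by
      rw [← Int.floor_add_one]; exact Int.floor_le_floor (by linarith)
    push_cast
    by_cases h : ⌊(i : ℝ) * x + θ⌋ = ⌊((i : ℝ) + 1) * x + θ⌋
    · simp [jumpSet, h]
    · simp only [jumpSet, Set.mem_ofPred_eq, ne_eq, h, not_false_eq_true, if_true]
      omega
  rw [Nat.cast_sum, Finset.sum_congr rfl fun i _ => hstep i]
  rw [Finset.sum_range_sub fun i : ℕ => ⌊(i : ℝ) * x + θ⌋]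
  simp

lemma abs_ncard_jumpSet_sub_le {x θ : ℝ} (hx0 : 0 ≤ x) (hx1 : x ≤ 1) (n : ℕ) :
    |(Set.ncard {i | i ≤ n ∧ i ∈ jumpSet x θ} : ℝ) - n * x| ≤ 2 := by
  have h : (Set.ncard {i | i ≤ n ∧ i ∈ jumpSet x θ} : ℝ) = ⌊((n : ℝ) + 1) * x + θ⌋ - ⌊θ⌋ := by
    exact_mod_cast ncard_jumpSet hx0 hx1 n
  rw [h, abs_le]
  have h1 := Int.floor_le (((n : ℝ) + 1) * x + θ)
  have h2 := Int.lt_floor_add_one (((n : ℝ) + 1) * x + θ)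
  have h3 := Int.floor_le θ
  have h4 := Int.lt_floor_add_one θ
  constructor <;> linarith

/-- A common jump would put an integer and a half-integer in the half-open interval `(i x, i x +
x]`, whose points are less than `1/2` apart. -/
lemma disjoint_jumpSet {x : ℝ} (hx0 : 0 ≤ x) (hx : x ≤ 1 / 2) :
    Disjoint (jumpSet x 0) (jumpSet x (1 / 2)) := by
  rw [Set.disjoint_left]
  intro i h1 h2
  set u := (i : ℝ) * x with hu
  have key : ∀ θ : ℝ, i ∈ jumpSet x θ → ∃ z : ℤ, u + θ < z ∧ z ≤ u + x + θ := by
    intro θ h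
    refine ⟨⌊u + θ⌋ + 1, by push_cast; exact Int.lt_floor_add_one _, ?_⟩
    have h1 : ⌊u + θ⌋ ≤ ⌊u + x + θ⌋ := Int.floor_le_floor (by linarith)
    have h2 : ⌊u + θ⌋ ≠ ⌊u + x + θ⌋ := by
      have : ((i : ℝ) + 1) * x + θ = u + x + θ := by rw [hu]; ring
      rw [← this]; exact h
    exact Int.le_floor.1 (by omega)
  obtain ⟨z, hz1, hz2⟩ := key _ h1
  obtain ⟨w, hw1, hw2⟩ := key _ h2
  have h3 : (z : ℝ) < w := by linarith
  have h4 : (w : ℝ) < z + 1 := by linarith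
  have h5 : z < w := by exact_mod_cast h3
  have h6 : w < z + 1 := by exact_mod_cast h4
  omega

lemma hasFrequency_of_mem_iff_jumpSet {x θ : ℝ} (hx0 : 0 ≤ x) (hx1 : x ≤ 1) {I : Set ℝ}
    {ω : ℕ → ℝ} {n₀ : ℕ} (h : ∀ i ≥ n₀, ω i ∈ I ↔ i ∈ jumpSet x θ) : HasFrequency I ω x := by
  refine tendsto_div_of_abs_sub_le (K := n₀ + 2) fun n => ?_
  have h1 := abs_ncard_sub_ncard_le (U := {i | ω i ∈ I}) h n
  have h2 := abs_ncard_jumpSet_sub_le (θ := θ) hx0 hx1 n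
  exact (abs_sub_le _ _ _).trans (add_le_add h1 h2)

/-! ### Closed target intervals inside `I`, inside `J` and off both. -/

lemma exists_Icc_subset_of_lt {I : Set ℝ} {a b : ℝ} (hab : a < b) (h : Set.Icc a b ⊆ I)
    (h01 : Set.Icc a b ⊆ Set.Icc 0 1) :
    ∃ a b : ℝ, 0 ≤ a ∧ a < b ∧ b < 1 ∧ b - a ≤ 1 / 2 ∧ Set.Icc a b ⊆ I := by
  have ha := (h01 (Set.left_mem_Icc.2 hab.le)).1
  have hb := (h01 (Set.right_mem_Icc.2 hab.le)).2
  -- Halving yields both `b < 1` and length at most `1/2`.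
  exact ⟨a, (a + b) / 2, ha, by linarith, by linarith, by linarith,
    (Set.Icc_subset_Icc_right (by linarith)).trans h⟩

lemma exists_Icc_subset_of_nontrivial {I : Set ℝ} (hI : I.OrdConnected) (hIn : I.Nontrivial)
    (hI01 : I ⊆ Set.Icc 0 1) :
    ∃ a b : ℝ, 0 ≤ a ∧ a < b ∧ b < 1 ∧ b - a ≤ 1 / 2 ∧ Set.Icc a b ⊆ I := by
  obtain ⟨a, ha, b, hb, hab⟩ := hIn.exists_lt
  exact exists_Icc_subset_of_lt hab (hI.out ha hb) ((hI.out ha hb).trans hI01)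

open MeasureTheory in
-- Convex sets have null frontier, so the closures of `I` and `J` still have total measure below 1
-- and miss a nonempty open part of `(0,1)`.
lemma exists_Icc_subset_compl {I J : Set ℝ} (hI : I.OrdConnected) (hJ : J.OrdConnected)
    (hvol : volume I + volume J < 1) :
    ∃ a b : ℝ, 0 ≤ a ∧ a < b ∧ b < 1 ∧ b - a ≤ 1 / 2 ∧ Set.Icc a b ⊆ (I ∪ J)ᶜ := by
  have hcl : ∀ S : Set ℝ, S.OrdConnected → volume (closure S) ≤ volume S := fun S hS => by
    rw [closure_eq_self_union_frontier]
    refine (measure_union_le _ _).trans ?_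
    rw [hS.convex.addHaar_frontier volume, add_zero]
  have hne : (Set.Ioo (0 : ℝ) 1 ∩ (closure I ∪ closure J)ᶜ).Nonempty := by
    by_contra! h
    have hsub : Set.Ioo (0 : ℝ) 1 ⊆ closure I ∪ closure J := fun x hx => by
      by_contra hx'
      exact (h ▸ (⟨hx, hx'⟩ : x ∈ Set.Ioo (0 : ℝ) 1 ∩ (closure I ∪ closure J)ᶜ) :
        x ∈ (∅ : Set ℝ))
    have h1 := (measure_mono hsub).trans
      ((measure_union_le _ _).trans (add_le_add (hcl I hI) (hcl J hJ)))
    rw [Real.volume_Ioo, sub_zero, ENNReal.ofReal_one] at h1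
    exact absurd hvol h1.not_gt
  obtain ⟨x, hx⟩ := hne
  have hopen : IsOpen (Set.Ioo (0 : ℝ) 1 ∩ (closure I ∪ closure J)ᶜ) :=
    isOpen_Ioo.inter (isClosed_closure.union isClosed_closure).isOpen_compl
  obtain ⟨ε, hε, hball⟩ := Metric.nhds_basis_closedBall.mem_iff.1 (hopen.mem_nhds hx)
  rw [Real.closedBall_eq_Icc] at hball
  exact exists_Icc_subset_of_lt (by linarith)
    (fun y hy hyIJ => (hball hy).2 (Set.union_subset_union subset_closure subset_closure hyIJ))
    fun y hy => Set.Ioo_subset_Icc_self (hball hy).1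

end CantorSeries

/-! ### Conclusion. -/

theorem mainTheorem5 (q : ℕ → ℕ) (hq : CantorSeries.IsBasicSequence q)
    (hlim : CantorSeries.InfiniteInLimit q)
    (I J : Set ℝ) (hI : I.OrdConnected) (hJ : J.OrdConnected)
    (hIn : I.Nontrivial) (hJn : J.Nontrivial)
    (hI01 : I ⊆ Set.Icc 0 1) (hJ01 : J ⊆ Set.Icc 0 1)
    (hIJ : Disjoint I J)
    (hvol : MeasureTheory.volume I + MeasureTheory.volume J < 1)
    (f g : Set.Icc (0 : ℝ) 1 → ℝ)
    (hfg : ∃ x₀ : Set.Icc (0 : ℝ) 1, (x₀ : ℝ) ≤ 1 / 2 ∧ f x₀ = g x₀) :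
    dimH {x : ℝ | x ∈ Set.Ico (0 : ℝ) 1 ∧
      ∃ a b : Set.Icc (0 : ℝ) 1,
        CantorSeries.HasFrequency I (fun n => CantorSeries.T q n x) a ∧
        CantorSeries.HasFrequency J (fun n => CantorSeries.T q n x) b ∧
        f a = g b} = 1 := by
  classical
  refine le_antisymm ((dimH_mono (Set.subset_univ _)).trans_eq Real.dimH_univ) ?_
  obtain ⟨⟨x₀, hx0, hx1⟩, hx2, hfg⟩ := hfg
  obtain ⟨a₁, b₁, ha₁, hab₁, hb₁, hl₁, hs₁⟩ :=
    CantorSeries.exists_Icc_subset_of_nontrivial hI hIn hI01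
  obtain ⟨a₂, b₂, ha₂, hab₂, hb₂, hl₂, hs₂⟩ :=
    CantorSeries.exists_Icc_subset_of_nontrivial hJ hJn hJ01
  obtain ⟨a₃, b₃, ha₃, hab₃, hb₃, hl₃, hs₃⟩ := CantorSeries.exists_Icc_subset_compl hI hJ hvol
  set U := CantorSeries.jumpSet x₀ 0
  set V := CantorSeries.jumpSet x₀ (1 / 2)
  have hUV : Disjoint U V := CantorSeries.disjoint_jumpSet hx0 hx2
  set α : ℕ → ℝ := fun i => if i ∈ U then a₁ else if i ∈ V then a₂ else a₃ with hα
  set β : ℕ → ℝ := fun i => if i ∈ U then b₁ else if i ∈ V then b₂ else b₃ with hβ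
  obtain ⟨δ, hδ, hδ₁, hδ₂, hδ₃⟩ : ∃ δ > 0, δ ≤ b₁ - a₁ ∧ δ ≤ b₂ - a₂ ∧ δ ≤ b₃ - a₃ :=
    ⟨min (b₁ - a₁) (min (b₂ - a₂) (b₃ - a₃)),
      lt_min (sub_pos.2 hab₁) (lt_min (sub_pos.2 hab₂) (sub_pos.2 hab₃)), min_le_left _ _,
      (min_le_right _ _).trans (min_le_left _ _), (min_le_right _ _).trans (min_le_right _ _)⟩
  obtain ⟨E, n₀, hE, hmem⟩ := CantorSeries.exists_dimH_tail_mem (p := fun i => q (i + 1))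
    (α := α) (β := β) (fun i => hq (i + 1) (by omega))
    ((tendsto_add_atTop_iff_nat 1).2 hlim) hδ
    (fun i => by simp only [hα]; split_ifs <;> assumption)
    (fun i => by simp only [hα, hβ]; split_ifs <;> linarith)
    (fun i => by simp only [hβ]; split_ifs <;> assumption)
    (fun i => by simp only [hα, hβ]; split_ifs <;> assumption)
  refine hE.trans (dimH_mono fun x hx => ?_)
  obtain ⟨e, he, rfl, htail⟩ := hmem x hx
  have hT := CantorSeries.T_digitSum (q := q) (e := e) he
  simp only [← hT] at htail
  -- Since `U` and `V` are disjoint, as are `I` and `J`, these cases give `T ∈ I ↔ i ∈ U` and `T ∈ J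
  -- ↔ i ∈ V` beyond `n₀`.
  have hcase : ∀ i ≥ n₀,
      (i ∈ U ∧ CantorSeries.T q i (CantorSeries.digitSum (fun i => q (i + 1)) e) ∈ I) ∨
      (i ∉ U ∧ i ∈ V ∧ CantorSeries.T q i (CantorSeries.digitSum (fun i => q (i + 1)) e) ∈ J) ∨
      (i ∉ U ∧ i ∉ V ∧
        CantorSeries.T q i (CantorSeries.digitSum (fun i => q (i + 1)) e) ∈ (I ∪ J)ᶜ) := by
    intro i hi
    have h := htail i hi
    by_cases hU : i ∈ U
    · exact Or.inl ⟨hU, hs₁ (by simpa [hα, hβ, hU] using h)⟩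
    by_cases hV : i ∈ V
    · exact Or.inr (Or.inl ⟨hU, hV, hs₂ (by simpa [hα, hβ, hU, hV] using h)⟩)
    · exact Or.inr (Or.inr ⟨hU, hV, hs₃ (by simpa [hα, hβ, hU, hV] using h)⟩)
  refine ⟨⟨CantorSeries.digitSum_nonneg _ e, CantorSeries.tail_lt_one he 0⟩,
    ⟨x₀, hx0, hx1⟩, ⟨x₀, hx0, hx1⟩,
    CantorSeries.hasFrequency_of_mem_iff_jumpSet (θ := 0) (n₀ := n₀) hx0 hx1 fun i hi => ?_,
    CantorSeries.hasFrequency_of_mem_iff_jumpSet (θ := 1 / 2) (n₀ := n₀) hx0 hx1 fun i hi => ?_,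
    hfg⟩
  · rcases hcase i hi with ⟨hU, h⟩ | ⟨hU, hV, h⟩ | ⟨hU, hV, h⟩
    · exact iff_of_true h hU
    · exact iff_of_false (Set.disjoint_right.1 hIJ h) hU
    · exact iff_of_false (fun h' => h (Or.inl h')) hU
  · rcases hcase i hi with ⟨hU, h⟩ | ⟨hU, hV, h⟩ | ⟨hU, hV, h⟩
    · exact iff_of_false (Set.disjoint_left.1 hIJ h) (Set.disjoint_left.1 hUV hU)
    · exact iff_of_true h hV
    · exact iff_of_false (fun h' => h (Or.inr h')) hV
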